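/- Let $n$ be a positive integer, let $I$ be a set, let $R=\prod_{i\in I}\mathbb{Z}/n\mathbb{Z}$, let $l\ge 0$ be an integer and let $a_1,\dots,a_l\in R$. The following conditions are equivalent. (1) The equation $a_1x_1+\dots+a_lx_l=0$ is partition regular over $R$: for every integer $r\ge 1$ and every colouring $\chi\colon R\to\{1,\dots,r\}$ there is a solution $(x_1,\dots,x_l)\in R^l$, not all of whose entries are zero, with $\chi(x_1)=\dots=\chi(x_l)$. (2) The $1\times l$ matrix $(a_1,\dots,a_l)$ satisfies the generalised columns condition over $R$. Here a $k\times l$ matrix over a commutative ring $R$ with columns $\mathbf c_1,\dots,\mathbf c_l\in R^k$ satisfies the generalised columns condition if there exist an integer $m\ge 0$, a partition $\{1,\dots,l\}=I_0\cup I_1\cup\dots\cup I_m$ into nonempty pairwise disjoint sets, and elements $d_0,\dots,d_m\in R\setminus\{0\}$ such that - $d_0\sum_{j\in I_0}\mathbf c_j=0$; - for every $t\in\{1,\dots,m\}$ the vector $d_t\sum_{j\in I_t}\mathbf c_j$ lies in the $R$-module generated by the columns $\mathbf c_j$ with $j\in I_0\cup\dots\cup I_{t-1}$; - if $m>0$,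 then for each integer $s\ge 0$ the ideal $d_0(d_1\cdots d_m)^sR$ is infinite. -/

import Mathlib

/-- The `k × l` matrix `A` over the commutative ring `R` is partition regular over the `R`-module
`M` for `r` colours: for every colouring of `M` with `r` colours the system `A m = 0` has a
solution `m ∈ M ^ l`, `m ≠ 0`, all of whose entries have the same colour. -/
def PartitionRegularFor {R : Type*} [CommRing R] {k l : ℕ} (A : Matrix (Fin k) (Fin l) R)
    (M : Type*) [AddCommGroup M] [Module R M] (r : ℕ) : Prop :=
  ∀ χ : M → Fin r, ∃ m : Fin l → M,
    (∀ i, ∑ j, A i j • m j = 0) ∧ (∀ j j', χ (m j) = χ (m j')) ∧ m ≠ 0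

/-- `A` is partition regular over `M`: it is so for every finite number `r ≥ 1` of colours. -/
def PartitionRegularOver {R : Type*} [CommRing R] {k l : ℕ} (A : Matrix (Fin k) (Fin l) R)
    (M : Type*) [AddCommGroup M] [Module R M] : Prop :=
  ∀ r : ℕ, 1 ≤ r → PartitionRegularFor A M r

/-- The generalised columns condition: there are `m ≥ 0`, a partition of the index set of the
columns into (nonempty, pairwise disjoint) sets `P 0, …, P m`, and nonzero `d 0, …, d m` in `R`
such that
* `d 0` annihilates the sum of the columns in `P 0`;
* for `1 ≤ t ≤ m`, `d t` times the sum of the columns in `P t` lies in the `R`-module generated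
  by the columns in `P 0 ∪ ⋯ ∪ P (t - 1)`;
* if `m > 0`, the ideal generated by `d 0 * (d 1 ⋯ d m) ^ n` is infinite for every `n ≥ 0`. -/
def GeneralisedColumnsCondition {R : Type*} [CommRing R] {k l : ℕ}
    (A : Matrix (Fin k) (Fin l) R) : Prop :=
  ∃ (m : ℕ) (P : Fin (m + 1) → Finset (Fin l)) (d : Fin (m + 1) → R),
    ((∀ t, (P t).Nonempty) ∧ (∀ s t, s ≠ t → Disjoint (P s) (P t)) ∧ (∀ j, ∃ t, j ∈ P t)) ∧
    (∀ t, d t ≠ 0) ∧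
    d 0 • ∑ j ∈ P 0, A.col j = 0 ∧
    (∀ t, t ≠ 0 → d t • ∑ j ∈ P t, A.col j ∈
      Submodule.span R {c : Fin k → R | ∃ s < t, ∃ j ∈ P s, c = A.col j}) ∧
    (0 < m → ∀ n : ℕ, (Ideal.span {d 0 * (∏ t : Fin m, d t.succ) ^ n} : Set R).Infinite)

/-! Write `K` for the finite ring of values. Both conditions are shown equivalent to one
disjunction: `HasConstantSolution` or `HasAnnihilatedPartialSum`. Sufficiency for regularity is
Brauer's theorem on the ideal `(c)`: a monochromatic `w`, `d`, `w + t • d` supported on coordinates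
with equal coefficients is distributed over the variables, the invertible term absorbing the
contribution of `d`. Necessity uses a colouring by leading values along a well-order of `I`, as in
Rado's colouring by leading digits: the first coordinate where a surviving term is nonzero exhibits
the annihilated partial sum. In both necessity arguments `exists_smul_simple` replaces a nonzero
element by a multiple on which each scalar is either zero or invertible, a substitute for working
over a field. -/

/-- A nonzero cyclic submodule of least size has no smaller nonzero submodule of the form `K • t • w
• x`, hence each `t` kills its generator or can be undone on it. -/
theorem exists_smul_simple {K M : Type*} [CommRing K] [Finite K] [AddCommGroup M] [Module K M]
    {x : M} (hx : x ≠ 0) :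
    ∃ w : K, w • x ≠ 0 ∧ ∀ t : K, t • w • x = 0 ∨ ∃ u : K, u • t • w • x = w • x := by
  obtain ⟨w, hw, hmin⟩ := (measure fun w : K => (Set.range fun s : K => s • w • x).ncard).wf.has_min
    {w | w • x ≠ 0} ⟨1, by simpa using hx⟩
  refine ⟨w, hw, fun t => or_iff_not_imp_left.2 fun ht => ?_⟩
  have hsub : (Set.range fun s : K => s • (t * w) • x) ⊆ Set.range fun s : K => s • w • x := by
    rintro _ ⟨s, rfl⟩
    exact ⟨s * t, by simp only [mul_smul]⟩
  have hcard := hmin (t * w) (by simpa only [Set.mem_ofPred_eq, mul_smul] using ht)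
  have heq := Set.eq_of_subset_of_ncard_le hsub (not_lt.1 hcard) (Set.finite_range _)
  obtain ⟨u, hu⟩ : w • x ∈ Set.range fun s : K => s • (t * w) • x := by
    rw [heq]
    exact ⟨1, one_smul _ _⟩
  exact ⟨u, by simpa only [mul_smul] using hu⟩

/-- Provides the exponent at which the infinite-ideal condition is applied: on multiples of `x ^ s`,
the factor `x ^ (k + 1)` acts as the identity. -/
theorem exists_pow_eq_pow_of_finite (K : Type*) [Monoid K] [Finite K] :
    ∃ s k : ℕ, ∀ x : K, x ^ (s + (k + 1)) = x ^ s := by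
  obtain ⟨s, t, hne, h⟩ := Finite.exists_ne_map_eq_of_infinite fun (s : ℕ) (x : K) => x ^ s
  rcases lt_or_gt_of_ne hne with hlt | hlt
  · obtain ⟨k, rfl⟩ := Nat.exists_eq_add_of_lt hlt
    exact ⟨s, k, fun x => (congrFun h x).symm⟩
  · obtain ⟨k, rfl⟩ := Nat.exists_eq_add_of_lt hlt
    exact ⟨t, k, fun x => congrFun h x⟩

/-- A value of each nonzero function at the first point of its support. -/
theorem exists_leading_value (I K : Type*) [LinearOrder I] [WellFoundedLT I] [Zero K] :
    ∃ lead : (I → K) → K, lead 0 = 0 ∧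
      ∀ y, y ≠ 0 → lead y ≠ 0 ∧ ∃ i, y i = lead y ∧ ∀ i' < i, y i' = 0 := by
  have h : ∀ y : I → K, ∃ c : K, (y = 0 → c = 0) ∧
      (y ≠ 0 → c ≠ 0 ∧ ∃ i, y i = c ∧ ∀ i' < i, y i' = 0) := by
    intro y
    by_cases hy : y = 0
    · exact ⟨0, fun _ => rfl, fun h => absurd hy h⟩
    · obtain ⟨i, hi, hmin⟩ := (wellFounded_lt (α := I)).has_min {i | y i ≠ 0}
        (Function.ne_iff.1 hy)
      exact ⟨y i, fun h => absurd h hy, fun _ => ⟨hi, i, rfl, fun i' hi' =>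
        by_contra fun hne => hmin i' hne hi'⟩⟩
  choose lead h0 h1 using h
  exact ⟨lead, h0 0 rfl, h1⟩

/-! ### Brauer's theorem via Hales–Jewett -/

/-- Brauer's theorem for powers of a finite module, with the nonzero vectors in at most `k`
colours. -/
theorem exists_mono_brauer_of_card_le {K F κ : Type*} [Ring K] [AddCommGroup F] [Module K F]
    [Finite F] [Nontrivial F] [Finite κ] (t : K) (k : ℕ) :
    ∃ (ι : Type) (_ : Fintype ι), ∀ (χ : (ι → F) → κ) (S : Finset κ), S.card ≤ k →
      (∀ x, x ≠ 0 → χ x ∈ S) → ∃ w d, d ≠ 0 ∧ χ w = χ d ∧ χ (w + t • d) = χ d := by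
  classical
  induction k with
  | zero =>
    refine ⟨Unit, inferInstance, fun χ S hS h => ?_⟩
    obtain ⟨x, hx⟩ := exists_ne (0 : Unit → F)
    have := h x hx
    simp [Finset.card_eq_zero.1 (Nat.le_zero.1 hS)] at this
  | succ k ih =>
    obtain ⟨η, _, ih⟩ := ih
    -- The extra direction `none` ensures that the monochromatic subspace has a nonzero point even
    -- if `η` is empty, so its colour lies in `S`.
    obtain ⟨ι, _, hι⟩ := Combinatorics.Subspace.exists_mono_in_high_dimension F κ (Option η)
    refine ⟨ι, inferInstance, fun χ S hS h => ?_⟩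
    obtain ⟨l, c, hc⟩ := hι χ
    have hcS : c ∈ S := by
      obtain ⟨f, hf⟩ := exists_ne (0 : F)
      obtain ⟨i, hi⟩ := l.proper none
      have hne : l (fun _ => f) ≠ 0 := fun h0 => hf (by
        simpa [Combinatorics.Subspace.apply_inr hi] using congrFun h0 i)
      exact hc (fun _ => f) ▸ h _ hne
    -- `L` is the linear part of the subspace in the directions `η`. Either some nonzero `L v` has
    -- the colour `c` of the subspace, and `l 0`, `L v` finish, or `c` is absent from the nonzero `L
    -- v` and induction applies.
    let L : (η → F) → ι → F := fun v i => (l.idxFun i).elim 0 fun o => o.elim 0 v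
    have hL : ∀ v, l 0 + L v = l fun o => o.elim 0 v := by
      intro v
      ext i
      rcases hi : l.idxFun i with x | o
      · simp [L, hi, Combinatorics.Subspace.apply_inl hi]
      · simp [L, hi, Combinatorics.Subspace.apply_inr hi]
    have hLadd : ∀ v d, L (v + t • d) = L v + t • L d := by
      intro v d
      ext i
      rcases hi : l.idxFun i with x | _ | e <;> simp [L, hi]
    have hLne : ∀ v, v ≠ 0 → L v ≠ 0 := by
      intro v hv h0
      apply hv
      ext e
      obtain ⟨i, hi⟩ := l.proper (some e)
      simpa [L, hi] using congrFun h0 i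
    have hLsmul : ∀ v, L (t • v) = t • L v := fun v => by
      have h0 : L 0 = 0 := by
        ext i
        rcases hi : l.idxFun i with x | _ | e <;> simp [L, hi]
      simpa [h0] using hLadd 0 v
    by_cases hd : ∃ v, v ≠ 0 ∧ χ (L v) = c
    · obtain ⟨v, hv, hvc⟩ := hd
      refine ⟨l 0, L v, hLne v hv, ?_, ?_⟩
      · rw [hc, hvc]
      · rw [← hLsmul, hL, hc, hvc]
    · push Not at hd
      obtain ⟨w, d, hd0, h1, h2⟩ := ih (fun v => χ (L v)) (S.erase c)
        (by rw [Finset.card_erase_of_mem hcS]; omega)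
        fun x hx => Finset.mem_erase.2 ⟨hd x hx, h _ (hLne x hx)⟩
      exact ⟨L w, L d, hLne d hd0, h1, by simpa only [hLadd] using h2⟩

theorem exists_mono_brauer {K : Type*} (F κ : Type*) [Ring K] [AddCommGroup F] [Module K F]
    [Finite F] [Nontrivial F] [Finite κ] (t : K) :
    ∃ (ι : Type) (_ : Fintype ι), ∀ χ : (ι → F) → κ,
      ∃ w d, d ≠ 0 ∧ χ w = χ d ∧ χ (w + t • d) = χ d := by
  have := Fintype.ofFinite κ
  obtain ⟨ι, _, h⟩ := exists_mono_brauer_of_card_le (F := F) (κ := κ) t (Fintype.card κ)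
  exact ⟨ι, inferInstance, fun χ => h χ Finset.univ le_rfl fun _ _ => Finset.mem_univ _⟩

/-- The equation with coefficients `a` has a nonzero constant solution. -/
def HasConstantSolution {R : Type*} [CommRing R] {l : ℕ} (a : Fin l → R) : Prop :=
  0 < l ∧ ∃ d : R, d ≠ 0 ∧ (∑ j, a j) * d = 0

/-- On an infinite set of coordinates with the same coefficients, some `c ≠ 0` annihilates a
partial sum of the coefficients that has a term acting invertibly on `c`. -/
def HasAnnihilatedPartialSum {I K : Type*} [CommRing K] {l : ℕ} (a : Fin l → I → K) : Prop :=
  ∃ (i : I) (c u : K) (J : Finset (Fin l)) (j : Fin l),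
    {i' | ∀ j, a j i' = a j i}.Infinite ∧ c ≠ 0 ∧ j ∈ J ∧ (∑ j ∈ J, a j i) * c = 0 ∧
      u * (a j i * c) = c

/-! ### Sufficiency of the two alternatives -/

theorem sum_col_replicateRow {R : Type*} [CommRing R] {l : ℕ} (a : Fin l → R)
    (J : Finset (Fin l)) :
    ∑ j ∈ J, (Matrix.replicateRow (Fin 1) a).col j = fun _ => ∑ j ∈ J, a j := by
  ext
  rw [Finset.sum_apply]
  rfl

theorem HasConstantSolution.partitionRegularOver {R : Type*} [CommRing R] {l : ℕ} {a : Fin l → R}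
    (h : HasConstantSolution a) :
    PartitionRegularOver (Matrix.replicateRow (Fin 1) a) R := by
  obtain ⟨hl, d, hd, h0⟩ := h
  refine fun r _ χ => ⟨fun _ => d, fun _ => ?_, fun _ _ => rfl, fun h => hd (congrFun h ⟨0, hl⟩)⟩
  simpa [← Finset.sum_mul] using h0

theorem HasConstantSolution.generalisedColumnsCondition {R : Type*} [CommRing R] {l : ℕ}
    {a : Fin l → R} (h : HasConstantSolution a) :
    GeneralisedColumnsCondition (Matrix.replicateRow (Fin 1) a) := by
  obtain ⟨hl, d, hd, h0⟩ := h
  refine ⟨0, fun _ => Finset.univ, fun _ => d,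
    ⟨fun _ => ⟨⟨0, hl⟩, Finset.mem_univ _⟩, fun s t hst =>
      absurd (Subsingleton.elim (α := Fin 1) s t) hst,
      fun _ => ⟨0, Finset.mem_univ _⟩⟩, fun _ => hd, ?_,
    fun t ht => absurd (Subsingleton.elim (α := Fin 1) t 0) ht, fun h => absurd h (lt_irrefl 0)⟩
  rw [sum_col_replicateRow]
  ext : 1
  simpa [mul_comm] using h0

/-- If `J` is everything, `c` placed at the single coordinate `i` gives a constant solution.
Otherwise `Jᶜ` can serve as a second block. -/
theorem HasAnnihilatedPartialSum.hasConstantSolution_or {I K : Type*} [CommRing K] {l : ℕ}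
    {a : Fin l → I → K} (h : HasAnnihilatedPartialSum a) :
    HasConstantSolution a ∨ ∃ (i : I) (c u : K) (J : Finset (Fin l)) (j : Fin l),
    {i' | ∀ j, a j i' = a j i}.Infinite ∧ c ≠ 0 ∧ j ∈ J ∧ (∑ j ∈ J, a j i) * c = 0 ∧
      u * (a j i * c) = c ∧ (Jᶜ).Nonempty := by
  classical
  obtain ⟨i, c, u, J, j, hI, hc, hj, hJ, hu⟩ := h
  rcases (Jᶜ).eq_empty_or_nonempty with he | hne
  · rw [Finset.compl_eq_empty_iff] at he
    subst he
    refine .inl ⟨j.pos, Pi.single i c, by simpa using hc, ?_⟩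
    ext i'
    rcases eq_or_ne i' i with rfl | hi
    · simpa using hJ
    · simp [hi]
  · exact .inr ⟨i, c, u, J, j, hI, hc, hj, hJ, hu, hne⟩

theorem infinite_span_singleton_of_infinite_support {I K : Type*} [CommRing K] {x : I → K}
    (hx : {i | x i ≠ 0}.Infinite) : (Ideal.span {x} : Set (I → K)).Infinite := by
  classical
  have := hx.to_subtype
  refine Set.infinite_of_injective_forall_mem (α := {i | x i ≠ 0})
    (f := fun i => Pi.single i.1 1 * x) (fun i i' h => ?_)
    fun i => Ideal.mul_mem_left _ _ (Ideal.mem_span_singleton_self x)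
  by_contra hne
  have := congrFun h i.1
  simp [Subtype.coe_injective.ne hne] at this
  exact i.2 this

theorem infinite_support_of_infinite_span_singleton {I K : Type*} [CommRing K] [Finite K]
    {x : I → K} (hx : (Ideal.span {x} : Set (I → K)).Infinite) : {i | x i ≠ 0}.Infinite := by
  intro hfin
  have := hfin.to_subtype
  refine hx (Set.Finite.of_finite_image (f := fun y (i : {i | x i ≠ 0}) => y i.1)
    (Set.toFinite _) fun y hy z hz h => ?_)
  obtain ⟨s, rfl⟩ := Ideal.mem_span_singleton'.1 hy
  obtain ⟨t, rfl⟩ := Ideal.mem_span_singleton'.1 hz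
  ext i
  by_cases hi : x i = 0
  · simp [hi]
  · exact congrFun h ⟨i, hi⟩

theorem HasAnnihilatedPartialSum.generalisedColumnsCondition {I K : Type*} [CommRing K] {l : ℕ}
    {a : Fin l → I → K} (h : HasAnnihilatedPartialSum a) :
    GeneralisedColumnsCondition (Matrix.replicateRow (Fin 1) a) := by
  classical
  rcases h.hasConstantSolution_or with h | ⟨i, c, u, J, j, hI, hc, hj, hJ, hu, hne⟩
  · exact h.generalisedColumnsCondition
  let e : I → K := fun i' => if ∀ j, a j i' = a j i then 1 else 0
  have hac : a j i * c ≠ 0 := fun h0 => hc (by rw [← hu, h0, mul_zero])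
  have hpow : ∀ s : ℕ, c * a j i ^ s ≠ 0 := by
    intro s
    induction s with
    | zero => simpa using hc
    | succ s ih =>
      intro h0
      refine ih ?_
      calc c * a j i ^ s = u * (a j i * c) * a j i ^ s := by rw [hu]
        _ = u * (c * a j i ^ (s + 1)) := by ring
        _ = 0 := by rw [h0, mul_zero]
  -- Multiplying by `a j` puts any sum into the module generated by column `j`, and `j ∈ J`. The
  -- indicator `e` restricts to coordinates with the coefficients of `i`.
  refine ⟨1, ![J, Jᶜ], ![fun i' => e i' * c, fun i' => e i' * a j i'], ⟨?_, ?_, ?_⟩, ?_, ?_, ?_, ?_⟩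
  · rw [Fin.forall_fin_two]
    exact ⟨⟨j, hj⟩, hne⟩
  · simp [Fin.forall_fin_two, disjoint_compl_right, disjoint_compl_left]
  · intro j'
    rw [Fin.exists_fin_two]
    simpa using em _
  · rw [Fin.forall_fin_two]
    exact ⟨fun h => hc (by simpa [e] using congrFun h i), fun h => hac (by
      have h : a j i = 0 := by simpa [e] using congrFun h i
      rw [h, zero_mul])⟩
  · rw [sum_col_replicateRow]
    ext x i'
    by_cases hi : ∀ j, a j i' = a j i
    · simpa [e, hi, mul_comm] using hJ
    · simp [e, hi]
  · rw [Fin.forall_fin_two]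
    refine ⟨fun h => absurd rfl h, fun _ => ?_⟩
    have hmem : (Matrix.replicateRow (Fin 1) a).col j ∈ Submodule.span (I → K)
        {c : Fin 1 → I → K | ∃ s < 1, ∃ j ∈ (![J, Jᶜ] : Fin 2 → _) s,
          c = (Matrix.replicateRow (Fin 1) a).col j} :=
      Submodule.subset_span ⟨0, by simp, j, hj, rfl⟩
    convert Submodule.smul_mem _ (fun i' => e i' * ∑ j ∈ Jᶜ, a j i') hmem using 1
    rw [sum_col_replicateRow]
    ext x i'
    simp [Matrix.col]
    ring
  · intro _ s
    refine infinite_span_singleton_of_infinite_support (hI.mono fun i' hi => ?_)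
    have hi : ∀ j, a j i' = a j i := hi
    simpa [e, hi] using hpow s

theorem HasAnnihilatedPartialSum.partitionRegularOver {I K : Type*} [CommRing K] [Finite K]
    {l : ℕ} {a : Fin l → I → K} (h : HasAnnihilatedPartialSum a) :
    PartitionRegularOver (Matrix.replicateRow (Fin 1) a) (I → K) := by
  classical
  rcases h.hasConstantSolution_or with h | ⟨i, c, u, J, j, hI, hc, hj, hJ, hu, j₁, hj₁⟩
  · exact h.partitionRegularOver
  intro r _ χ
  have : Nontrivial (Ideal.span {c}) :=
    ⟨⟨c, Ideal.mem_span_singleton_self c⟩, 0, fun h => hc (congrArg Subtype.val h)⟩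
  obtain ⟨ι, _, hι⟩ := exists_mono_brauer (Ideal.span {c}) (Fin r) (-(u * ∑ j ∈ Jᶜ, a j i))
  have := hI.to_subtype
  let g : ι → {i' | ∀ j, a j i' = a j i} := fun e => Infinite.natEmbedding _ (Fintype.equivFin ι e)
  let f : ι → I := fun e => (g e).1
  have hf : Function.Injective f := Subtype.val_injective.comp
    ((Infinite.natEmbedding _).injective.comp
      (Fin.val_injective.comp (Fintype.equivFin ι).injective))
  have hfa : ∀ e j, a j (f e) = a j i := fun e => (g e).2
  let E : (ι → Ideal.span {c}) → I → K := fun x => Function.extend f (fun e => (x e : K)) 0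
  have hE : ∀ x e, E x (f e) = x e := fun x e => hf.extend_apply _ _ _
  have hE0 : ∀ x i', (¬ ∃ e, f e = i') → E x i' = 0 := fun x i' h =>
    Function.extend_apply' _ _ _ h
  obtain ⟨w, d, hd, h1, h2⟩ := hι fun x => χ (E x)
  -- On `J` the terms in `w` cancel since `(c)` is killed by the partial sum; the shift at `j`
  -- cancels the terms in `d` from `Jᶜ`, as `u` inverts `a j i` on `(c)`.
  let m : Fin l → ι → Ideal.span {c} := fun j' =>
    if j' ∈ J then (if j' = j then w + -(u * ∑ j ∈ Jᶜ, a j i) • d else w) else d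
  have hm : ∀ j', χ (E (m j')) = χ (E d) := by
    intro j'
    dsimp only [m]
    split_ifs
    exacts [h2, h1, rfl]
  refine ⟨fun j' => E (m j'), fun x => ?_, fun j' j'' => (hm j').trans (hm j'').symm,
    fun h0 => hd ?_⟩
  · ext i'
    by_cases hi : ∃ e, f e = i'
    · obtain ⟨e, rfl⟩ := hi
      obtain ⟨w', hw⟩ := Ideal.mem_span_singleton'.1 (w e).2
      obtain ⟨d', hd'⟩ := Ideal.mem_span_singleton'.1 (d e).2
      have hsum : ∀ g : Fin l → K, ∑ j', g j' * (m j' e : K) =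
          (∑ j' ∈ J, g j') * w e + (∑ j' ∈ Jᶜ, g j') * d e
            - g j * (u * (∑ j ∈ Jᶜ, a j i) * d e) := by
        intro g
        rw [← Finset.sum_add_sum_compl J, Finset.sum_mul, Finset.sum_mul]
        have hA : ∑ j' ∈ J, g j' * (m j' e : K) = ∑ j' ∈ J, (g j' * w e -
            if j' = j then g j' * (u * (∑ j ∈ Jᶜ, a j i) * d e) else 0) := by
          refine Finset.sum_congr rfl fun j' hj' => ?_
          dsimp only [m]
          rw [if_pos hj']
          split_ifs
          · simp; ring
          · simp
        have hB : ∑ j' ∈ Jᶜ, g j' * (m j' e : K) = ∑ j' ∈ Jᶜ, g j' * d e := by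
          refine Finset.sum_congr rfl fun j' hj' => ?_
          simp [m, Finset.mem_compl.1 hj']
        rw [hA, hB, Finset.sum_sub_distrib, Finset.sum_ite_eq' J j, if_pos hj]
        ring
      simp only [Matrix.replicateRow_apply, smul_eq_mul, Finset.sum_apply, Pi.mul_apply, hE, hfa,
        hsum fun j' => a j' i, Pi.zero_apply]
      rw [← hw, ← hd']
      linear_combination w' * hJ - d' * (∑ j ∈ Jᶜ, a j i) * hu
    · simp [hE0 _ _ hi]
  · ext e
    have := congrFun (congrFun h0 j₁) (f e)
    simpa [hE, m, Finset.mem_compl.1 hj₁] using this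

/-! ### Necessity: from the columns condition -/

theorem hasConstantSolution_or_of_generalisedColumnsCondition {I K : Type*} [CommRing K]
    [Finite K] {l : ℕ} {a : Fin l → I → K}
    (h : GeneralisedColumnsCondition (Matrix.replicateRow (Fin 1) a)) :
    HasConstantSolution a ∨ HasAnnihilatedPartialSum a := by
  classical
  obtain ⟨m, P, d, ⟨hne, -, hcov⟩, hd, h0, hspan, hinf⟩ := h
  have hl : 0 < l := (hne 0).choose.pos
  rw [sum_col_replicateRow] at h0
  have h0 : d 0 * ∑ j ∈ P 0, a j = 0 := congrFun h0 0
  rcases Nat.eq_zero_or_pos m with rfl | hm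
  · have hP : P 0 = Finset.univ := by
      refine Finset.eq_univ_iff_forall.2 fun j => ?_
      obtain ⟨t, ht⟩ := hcov j
      rwa [Subsingleton.elim (α := Fin 1) t 0] at ht
    exact .inl ⟨hl, d 0, hd 0, by rw [mul_comm, ← hP, h0]⟩
  obtain ⟨s, k, hpow⟩ := exists_pow_eq_pow_of_finite K
  set π : I → K := ∏ t : Fin m, d t.succ with hπ
  have hS := infinite_support_of_infinite_span_singleton (hinf hm s)
  have := hS.to_subtype
  obtain ⟨τ, hτ⟩ := Finite.exists_infinite_fiber
    fun (i : {i | (d 0 * π ^ s) i ≠ 0}) (j : Fin l) => a j i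
  obtain ⟨⟨⟨i, hi⟩, hiτ⟩⟩ := hτ.nonempty
  have hI : {i' | ∀ j, a j i' = a j i}.Infinite := by
    refine ((Set.infinite_coe_iff.1 hτ).image Subtype.val_injective.injOn).mono ?_
    rintro _ ⟨i', hi', rfl⟩ j
    exact (congrFun hi' j).trans (congrFun hiτ j).symm
  obtain ⟨w, hw, hc⟩ := exists_smul_simple (K := K) hi
  set c : K := w • (d 0 * π ^ s) i with hcdef
  have hcπ : c * π i ^ (k + 1) = c := by
    have := hpow (π i)
    simp only [hcdef, smul_eq_mul, Pi.mul_apply, Pi.pow_apply]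
    rw [pow_add] at this
    linear_combination w * d 0 i * this
  by_contra! hcon
  obtain ⟨hA, hB⟩ := hcon
  -- With no annihilated partial sum of the required kind, a block sum killing `c` forces every term
  -- to kill `c`. This propagates through the blocks.
  have hB : ∀ J : Finset (Fin l), (∑ j ∈ J, a j i) * c = 0 → ∀ j ∈ J, a j i * c = 0 := by
    intro J hJ j hj
    rcases hc (a j i) with h | ⟨u, hu⟩
    · exact h
    · exact absurd ⟨i, c, u, J, j, hI, hw, hj, hJ, hu⟩ hB
  have hall : ∀ t, ∀ j ∈ P t, a j i * c = 0 := by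
    intro t
    induction t using WellFoundedLT.induction with
    | ind t ih =>
      apply hB
      by_cases ht : t = 0
      · subst ht
        have h0 := congrFun h0 i
        simp only [Pi.mul_apply, Finset.sum_apply, Pi.zero_apply] at h0
        simp only [hcdef, smul_eq_mul, Pi.mul_apply]
        linear_combination w * (π ^ s) i * h0
      · have hann : ∀ y ∈ Submodule.span (I → K) {c : Fin 1 → I → K | ∃ s < t, ∃ j ∈ P s,
            c = (Matrix.replicateRow (Fin 1) a).col j}, y 0 i * c = 0 := by
          intro y hy
          induction hy using Submodule.span_induction with
          | mem y hy =>
            obtain ⟨s, hs, j, hj, rfl⟩ := hy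
            exact ih s hs j hj
          | zero => simp
          | add y z _ _ hy hz => simp only [Pi.add_apply, add_mul, hy, hz, add_zero]
          | smul b y _ hy =>
            simp only [Pi.smul_apply, smul_eq_mul, Pi.mul_apply, mul_assoc, hy, mul_zero]
        have h1 := hann _ (hspan t ht)
        rw [sum_col_replicateRow] at h1
        simp only [Pi.smul_apply, smul_eq_mul, Pi.mul_apply, Finset.sum_apply] at h1
        obtain ⟨t', rfl⟩ := Fin.exists_succ_eq.2 ht
        obtain ⟨v, hv⟩ : d t'.succ ∣ π := Finset.dvd_prod_of_mem _ (Finset.mem_univ t')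
        have hv := congrFun hv i
        rw [Pi.mul_apply] at hv
        -- The factor `d t'.succ` is extracted from `c = c * π i ^ (k + 1)`, so that `h1` applies.
        rw [← hcπ, pow_succ]
        nth_rewrite 2 [hv]
        linear_combination (π i ^ k * v i) * h1
  refine hA ⟨hl, Pi.single i c, by simpa using hw, ?_⟩
  ext i'
  rcases eq_or_ne i' i with rfl | hi'
  · simp only [Pi.mul_apply, Finset.sum_apply, Pi.single_eq_same, Finset.sum_mul, Pi.zero_apply]
    refine Finset.sum_eq_zero fun j _ => ?_
    obtain ⟨t, ht⟩ := hcov j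
    exact hall t j ht
  · simp [hi']

/-! ### Necessity: the leading-value colouring -/

theorem finite_setOf_finite_fiber {I T : Type*} [Finite T] (g : I → T) :
    {i | {i' | g i' = g i}.Finite}.Finite := by
  refine (Set.finite_iUnion (f := fun τ : {τ | {i' | g i' = τ}.Finite} => {i' | g i' = τ.1})
    fun τ => τ.2).subset fun i hi => ?_
  exact Set.mem_iUnion.2 ⟨⟨g i, hi⟩, rfl⟩

theorem hasConstantSolution_or_of_partitionRegularOver {I K : Type*} [CommRing K]
    [Finite K] {l : ℕ} {a : Fin l → I → K}
    (h : PartitionRegularOver (Matrix.replicateRow (Fin 1) a) (I → K)) :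
    HasConstantSolution a ∨ HasAnnihilatedPartialSum a := by
  classical
  obtain ⟨_, _⟩ := exists_wellFoundedLT I
  obtain ⟨lead, hlead0, hlead⟩ := exists_leading_value I K
  have hlead_iff : ∀ y, lead y = 0 ↔ y = 0 := fun y =>
    ⟨fun hy => by_contra fun hne => (hlead y hne).1 hy, fun hy => hy ▸ hlead0⟩
  let g : I → Fin l → K := fun i j => a j i
  let T : Set I := {i | {i' | g i' = g i}.Finite}
  have : Finite T := finite_setOf_finite_fiber g
  let res : (Fin l → K) → (I → K) → I → K := fun τ x i => if g i = τ then x i else 0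
  -- Leading values of all scalar multiples are recorded, so equal colours also mean equal
  -- annihilators on each fibre of `g`. On the finitely many coordinates in finite fibres the exact
  -- values are recorded.
  let col : (I → K) → ((Fin l → K) → K → K) × (T → K) :=
    fun x => (fun τ d => lead (d • res τ x), fun i => x i)
  obtain ⟨m, hsol, hmono, hne⟩ := h _ Nat.card_pos fun x => Finite.equivFin _ (col x)
  have hmono : ∀ j j', col (m j) = col (m j') := fun j j' => (Equiv.injective _) (hmono j j')
  have hsol : ∀ i, ∑ j, a j i * m j i = 0 := fun i => by simpa using congrFun (hsol 0) i
  obtain ⟨j₁, hj₁⟩ := Function.ne_iff.1 hne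
  obtain ⟨i₁, hi₁⟩ := Function.ne_iff.1 hj₁
  have hl : 0 < l := j₁.pos
  set τ := g i₁ with hτ
  have hres : res τ (m j₁) ≠ 0 := fun h0 => hi₁ (by simpa [res, hτ] using congrFun h0 i₁)
  by_cases hT : i₁ ∈ T
  · refine .inl ⟨hl, res τ (m j₁), hres, ?_⟩
    ext i
    by_cases hi : g i = τ
    · have hiT : i ∈ T := by
        change {i' | g i' = g i}.Finite
        rw [hi]
        exact hT
      have heq : ∀ j, m j i = m j₁ i := fun j =>
        congrFun (congrArg Prod.snd (hmono j j₁)) ⟨i, hiT⟩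
      simpa [res, hi, heq, Finset.sum_mul] using hsol i
    · simp [res, hi]
  have hI : {i' | ∀ j, a j i' = a j i₁}.Infinite := fun hfin =>
    hT (hfin.subset fun i hi j => congrFun hi j)
  obtain ⟨d, hd, hsimple⟩ := exists_smul_simple (K := K) hres
  set z : Fin l → I → K := fun j => d • res τ (m j) with hz
  have hzlead : ∀ t j, lead (t • z j) = lead (t • z j₁) := fun t j => by
    simpa [col, hz, mul_smul] using
      congrFun (congrFun (congrArg Prod.fst (hmono j j₁)) τ) (t * d)
  have hz0 : ∀ t j, t • z j = 0 ↔ t • z j₁ = 0 := fun t j => by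
    rw [← hlead_iff, hzlead, hlead_iff]
  have hzsum : ∀ i, ∑ j, τ j * z j i = 0 := by
    intro i
    by_cases hi : g i = τ
    · have := congrArg (d * ·) (hsol i)
      simp only [Finset.mul_sum, mul_zero] at this
      rw [← this]
      refine Finset.sum_congr rfl fun j _ => ?_
      have haj : a j i = τ j := congrFun hi j
      simp only [hz, res, Pi.smul_apply, if_pos hi, smul_eq_mul, haj]
      ring
    · simp [hz, res, hi]
  have hzne : ∀ j, z j ≠ 0 := fun j h0 => hd (by simpa using (hz0 1 j).1 (by simpa using h0))
  by_cases hall : ∀ j, τ j • z j₁ = 0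
  · refine .inl ⟨hl, z j₁, hd, ?_⟩
    ext i
    by_cases hi : g i = τ
    · simp only [Pi.mul_apply, Finset.sum_apply, Finset.sum_mul, Pi.zero_apply]
      refine Finset.sum_eq_zero fun j _ => ?_
      have := congrFun (hall j) i
      rwa [← hi] at this
    · simp [hz, res, hi]
  push Not at hall
  choose f hf hfmin using fun j => (hlead (z j) (hzne j)).2
  have hzf : ∀ j, z j (f j) = lead (z j₁) := fun j => (hf j).trans (by simpa using hzlead 1 j)
  -- At the earliest leading position `f j₀` among the variables not killed by their coefficients,
  -- only the terms with the same position survive in the equation, each with the common leading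
  -- value.
  obtain ⟨j₀, hj₀, hmin⟩ := Finset.exists_min_image
    (Finset.univ.filter fun j => τ j • z j₁ ≠ 0) f (hall.imp fun j hj => by simpa using hj)
  have hj₀ : τ j₀ • z j₁ ≠ 0 := (Finset.mem_filter.1 hj₀).2
  have hmin : ∀ j, τ j • z j₁ ≠ 0 → f j₀ ≤ f j := fun j hj => hmin j (by simpa using hj)
  obtain ⟨u, hu⟩ := (hsimple (τ j₀)).resolve_left hj₀
  refine .inr ⟨i₁, lead (z j₁), u,
    Finset.univ.filter fun j => τ j • z j₁ ≠ 0 ∧ f j = f j₀, j₀, hI, (hlead _ (hzne _)).1,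
    by simpa using hj₀, ?_, ?_⟩
  · rw [Finset.sum_mul, ← hzsum (f j₀), Finset.sum_filter]
    refine Finset.sum_congr rfl fun j _ => ?_
    split_ifs with hj
    · rw [← hj.2, hzf]
    · by_cases hj' : τ j • z j₁ = 0
      · exact (congrFun ((hz0 _ j).2 hj') (f j₀)).symm
      · rw [hfmin j _ (lt_of_le_of_ne (hmin j hj') fun he => hj ⟨hj', he.symm⟩), mul_zero]
  · rw [← hzf j₁]
    exact congrFun hu (f j₁)

theorem mainTheorem10 {I : Type*} (n : ℕ) (hn : 0 < n) (l : ℕ) (a : Fin l → (I → ZMod n)) :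
    PartitionRegularOver (Matrix.replicateRow (Fin 1) a) (I → ZMod n) ↔
      GeneralisedColumnsCondition (Matrix.replicateRow (Fin 1) a) := by
  have : NeZero n := ⟨hn.ne'⟩
  constructor
  · intro h
    rcases hasConstantSolution_or_of_partitionRegularOver h with h | h
    · exact h.generalisedColumnsCondition
    · exact h.generalisedColumnsCondition
  · intro h
    rcases hasConstantSolution_or_of_generalisedColumnsCondition h with h | h
    · exact h.partitionRegularOver
    · exact h.partitionRegularOver
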